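/- Let $\mathfrak g$ be a finite-dimensional simple complex Lie algebra of $ADE$ type, $\mathfrak h\subset\mathfrak g$ a Cartan subalgebra, $R\subset\mathfrak h^*$ the set of roots, and fix simple roots $\alpha_i$ with simple coroots $h_i\in\mathfrak h$, $i\in I$. Let $P^+=\{\lambda\in\mathfrak h^*: \lambda(h_i)\in\mathbb Z_{\ge 0}\ \forall i\in I\}$ be the set of dominant weights, and let $\omega_i\in P^+$, $i\in I$, be the fundamental weights, $\omega_i(h_j)=\delta_{ij}$. For $\omega\in P^+$ let $L(\omega)$ be the irreducible representation of $\mathfrak g$ with highest weight $\omega$, let $P_\omega\subset\mathfrak h^*$ be the set of its weights, and call the dimension of the weight space $L(\omega)_\mu$ the multiplicity of $\mu$. Let $\ell\in\mathfrak h$ be generic, in the sense that $\operatorname{Re}\alpha(\ell)\neq 0$ for every $\alpha\in R$, and put $R_\ell^+=\{\alpha\in R:\operatorname{Re}\alpha(\ell)>0\}$. Then there is a unique element $w_\ell$ of the Weyl group which maps the fundamental Weyl chamber (the one defined by the simple roots $\alpha_i$) onto the Weyl chamber defined by the system of positive roots $R_\ell^+$, and the following hold. (1) For every $\omega\in P^+$,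 the weight $w_\ell(\omega)$ belongs to $P_\omega$, has multiplicity one, and $$\operatorname{Re} w_\ell(\omega)(\ell)>\operatorname{Re}\lambda(\ell)\qquad\text{for every }\lambda\in P_\omega,\ \lambda\neq w_\ell(\omega).$$ (2) For every $i\in I$, the weight $w_\ell(\omega_i-\alpha_i)$ belongs to $P_{\omega_i}$, has multiplicity one, and $$\operatorname{Re} w_\ell(\omega_i)(\ell)>\operatorname{Re} w_\ell(\omega_i-\alpha_i)(\ell)>\operatorname{Re}\lambda(\ell)$$ for every $\lambda\in P_{\omega_i}$ with $\lambda\neq w_\ell(\omega_i),\,w_\ell(\omega_i-\alpha_i)$. -/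

import Mathlib

open LieAlgebra LieAlgebra.IsKilling Module

noncomputable section

/-! Throughout, `g` is a finite-dimensional complex Lie algebra with non-degenerate Killing form
(equivalently, semisimple), `H` is a Cartan subalgebra, `rootSystem H` is the root system of
`(g, H)` (with roots in the dual of `H` and coroots in `H`), and `b` is a base of it, that is,
a choice of simple roots `α i` with simple coroots `h i`, `i ∈ b.support`. -/

namespace ODEIM

section Weights

variable {g : Type*} [LieRing g] [LieAlgebra ℂ g] [FiniteDimensional ℂ g] [IsKilling ℂ g]
  {H : LieSubalgebra ℂ g} [H.IsCartanSubalgebra]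

/-- Dominant integral weights: `ω (h i)` is a non-negative integer for every simple coroot. -/
def IsDominantIntegral (b : (rootSystem H).Base) (ω : Dual ℂ H) : Prop :=
  ∀ i ∈ b.support, ∃ n : ℕ, ω ((rootSystem H).coroot i) = n

/-- The fundamental weight `ω i`: the simple coroots form a basis of `H`, and the fundamental
weights are the coordinate functions of this basis, so that `ω i (h j) = δ i j`. -/
def fundamentalWeight (b : (rootSystem H).Base) (i : b.support) : Dual ℂ H :=
  b.toCoweightBasis.coord i

/-- `v` is a highest weight vector of weight `ω`: it is non-zero, `H` acts on it through `ω`, and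
it is annihilated by the root spaces of all simple roots (these are the lines spanned by the
Chevalley generators `e i`). -/
structure IsHighestWeightVector (b : (rootSystem H).Base) (ω : Dual ℂ H)
    {V : Type*} [AddCommGroup V] [Module ℂ V] [LieRingModule g V] [LieModule ℂ g V]
    (v : V) : Prop where
  ne_zero : v ≠ 0
  lie_cartan : ∀ h : H, ⁅(h : g), v⁆ = ω h • v
  lie_simple : ∀ i ∈ b.support, ∀ x ∈ rootSpace H ((rootSystem H).root i), ⁅(x : g), v⁆ = 0

/-- `V` is (a model of) the irreducible representation `L(ω)` of highest weight `ω`. No finiteness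
of the dimension is built in. -/
def IsIrreducibleHighestWeight (b : (rootSystem H).Base) (ω : Dual ℂ H)
    (V : Type*) [AddCommGroup V] [Module ℂ V] [LieRingModule g V] [LieModule ℂ g V] : Prop :=
  LieModule.IsIrreducible ℂ g V ∧ ∃ v : V, IsHighestWeightVector b ω v

/-- The weight space `V_μ`, consisting of all `v` with `h v = μ(h) v` for all `h` in `H`. -/
abbrev weightSpaceOf (V : Type*) [AddCommGroup V] [Module ℂ V] [LieRingModule g V]
    [LieModule ℂ g V] (μ : Dual ℂ H) : LieSubmodule ℂ H V :=
  LieModule.weightSpace V (fun h : H => μ h)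

/-- The weights of `V`: those `μ` whose weight space is non-zero. -/
def weights (H : LieSubalgebra ℂ g) [H.IsCartanSubalgebra]
    (V : Type*) [AddCommGroup V] [Module ℂ V] [LieRingModule g V]
    [LieModule ℂ g V] : Set (Dual ℂ H) :=
  {μ | weightSpaceOf V μ ≠ ⊥}

/-- The multiplicity of `μ` in `V`: the dimension of the weight space, as a cardinal. -/
def multiplicity (V : Type*) [AddCommGroup V] [Module ℂ V] [LieRingModule g V]
    [LieModule ℂ g V] (μ : Dual ℂ H) : Cardinal :=
  Module.rank ℂ (weightSpaceOf V μ)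

/-- `ℓ` is generic: no root takes a purely imaginary value on `ℓ`. Equivalently, the roots split
into the two complementary sets `{α | 0 < Re α(ℓ)}` and `{α | Re α(ℓ) < 0}`. -/
def IsGeneric (ℓ : H) : Prop :=
  ∀ α : H.root, ((rootSystem H).root α ℓ).re ≠ 0

/-- The roots which are positive with respect to `ℓ`. -/
def positiveRoots (ℓ : H) : Set H.root :=
  {α | 0 < ((rootSystem H).root α ℓ).re}

/-- The (open) cone in the real span of the roots cut out by the inequalities `μ(α^∨) > 0`,
`α ∈ S`, where `α^∨` is the coroot of `α`. It is a Weyl chamber when `S` is the set of positive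
roots of some system of positive roots, or the set of its simple roots (which gives the same
cone). -/
def weylChamber (S : Set H.root) : Set (Dual ℂ H) :=
  {μ | ∀ α ∈ S, (μ ((rootSystem H).coroot α)).im = 0 ∧ 0 < (μ ((rootSystem H).coroot α)).re}

/-- `w` is an element of the Weyl group associated with `ℓ`: it maps the fundamental Weyl chamber,
given by the simple roots of `b`, onto the Weyl chamber of the positive roots with respect to
`ℓ`. -/
def IsAssociated (b : (rootSystem H).Base) (ℓ : H) (w : (rootSystem H).weylGroup) : Prop :=
  (fun μ : Dual ℂ H => w • μ) '' weylChamber (b.support : Set H.root) =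
    weylChamber (positiveRoots ℓ)

end Weights

end ODEIM

end

/-! Pull everything back by `w`. The additive functional μ ↦ Re (wμ)(ℓ), `reEval`, is positive on
the simple roots exactly when `w` is associated with ℓ (`isAssociated_iff`), and multiplicities are
Weyl invariant, so both claims concern `w = 1` and any functional positive on the simple roots. For
(1), every weight is ω minus a sum of simple roots. For (2), f_j v = 0 for j ≠ i because ω_i(h_j) =
0, so a weight other than ω_i lies in ω_i - α_i minus such a sum, and f_i v spans the weight space
of ω_i - α_i.

Since V is not assumed finite-dimensional, Weyl invariance comes from local nilpotence of the simple
root vectors: f_i^(n+1) v = 0 for n = ω(h_i), as otherwise it would be a second highest weight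
vector, of lower weight. Existence of `w` follows by maximizing Re (wρ)(ℓ) over the finite Weyl
group, uniqueness from the exchange property. -/

set_option linter.unusedSectionVars false

/-! ### Representations of sl₂ with locally nilpotent action -/

namespace IsSl2Triple

variable {K L M : Type*} [Field K] [CharZero K] [LieRing L] [LieAlgebra K L]
  [AddCommGroup M] [Module K M] [LieRingModule L M] [LieModule K L M] {h e f : L}

lemma lie_h_pow_toEnd_f (t : IsSl2Triple h e f) {u : M} {c : K} (hu : ⁅h, u⁆ = c • u) (n : ℕ) :
    ⁅h, (LieModule.toEnd K L M f ^ n) u⁆ = (c - 2 * n) • (LieModule.toEnd K L M f ^ n) u := by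
  have := t.symm.lie_h_pow_toEnd_e (R := K) (μ := -c) (m := u) (by simp [hu]) n
  rw [neg_lie, neg_eq_iff_eq_neg] at this
  rw [this]
  module

/-- Moving e past each f leaves an h, and the eigenvalues c - 2k for k ≤ n sum to (n + 1)(c - n).
The first term remains because u need not be primitive. -/
lemma lie_e_pow_succ_toEnd_f (t : IsSl2Triple h e f) {u : M} {c : K} (hu : ⁅h, u⁆ = c • u)
    (n : ℕ) :
    ⁅e, (LieModule.toEnd K L M f ^ (n + 1)) u⁆ =
      (LieModule.toEnd K L M f ^ (n + 1)) ⁅e, u⁆ +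
        ((n + 1) * (c - n)) • (LieModule.toEnd K L M f ^ n) u := by
  induction n with
  | zero => simp [leibniz_lie e f u, t.lie_e_f, hu, add_comm]
  | succ n ih =>
    rw [pow_succ' _ (n + 1), Module.End.mul_apply, LieModule.toEnd_apply_apply, leibniz_lie e,
      t.lie_e_f, t.lie_h_pow_toEnd_f hu, ih, lie_add, lie_smul, Module.End.mul_apply,
      LieModule.toEnd_apply_apply, ← LieModule.toEnd_apply_apply K L M f
        ((LieModule.toEnd K L M f ^ n) u), ← Module.End.mul_apply, ← pow_succ']
    push_cast
    module

/-- On a module on which `e` is locally nilpotent, `f ^ m` is injective on the eigenspace of `h`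
of eigenvalue `m`. -/
lemma eq_zero_of_pow_toEnd_f_eq_zero (t : IsSl2Triple h e f) (k : ℕ) {m : ℕ} {u : M}
    (hu : ⁅h, u⁆ = (m : K) • u) (he : (LieModule.toEnd K L M e ^ k) u = 0)
    (hf : (LieModule.toEnd K L M f ^ m) u = 0) : u = 0 := by
  induction k generalizing m u with
  | zero => simpa using he
  | succ k ih =>
    have hfe : (LieModule.toEnd K L M f ^ (m + 1)) ⁅e, u⁆ = 0 := by
      -- With c = n = m the scalar (n + 1)(c - n) vanishes.
      have := t.lie_e_pow_succ_toEnd_f hu m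
      rwa [pow_succ' _ m, Module.End.mul_apply, hf, map_zero, lie_zero, sub_self, mul_zero,
        zero_smul, add_zero, ← pow_succ', eq_comm] at this
    have heu : ⁅e, u⁆ = 0 := by
      -- e raises the h-eigenvalue by 2, so the induction has to let m vary.
      refine ih (m := m + 2) ?_ ?_ ?_
      · simpa using t.lie_h_pow_toEnd_e (R := K) hu 1
      · rwa [pow_succ, Module.End.mul_apply] at he
      · rw [pow_succ', Module.End.mul_apply, hfe, map_zero]
    by_contra hne
    exact HasPrimitiveVectorWith.pow_toEnd_f_ne_zero_of_eq_nat (t := t) (μ := (m : K))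
      ⟨hne, hu, heu⟩ rfl le_rfl hf

end IsSl2Triple

/-! ### Weight spaces, root vectors and generation of `g` -/

namespace ODEIM

variable {g : Type*} [LieRing g] [LieAlgebra ℂ g] [FiniteDimensional ℂ g] [IsKilling ℂ g]
  {H : LieSubalgebra ℂ g} [H.IsCartanSubalgebra]
  {V : Type*} [AddCommGroup V] [Module ℂ V] [LieRingModule g V] [LieModule ℂ g V]

lemma mem_weightSpaceOf {μ : Dual ℂ H} {v : V} :
    v ∈ weightSpaceOf V μ ↔ ∀ h : H, ⁅(h : g), v⁆ = μ h • v := by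
  simp [LieModule.mem_weightSpace]

/-- `rootSpace` is a generalized eigenspace; it is a true one because the Killing form is
non-degenerate. In this form `g` can serve as the module V. -/
lemma mem_rootSpace_iff (χ : Dual ℂ H) {x : g} :
    x ∈ rootSpace H χ ↔ ∀ h : H, ⁅(h : g), x⁆ = χ h • x := by
  refine ⟨fun hx h ↦ lie_eq_smul_of_mem_rootSpace hx h, fun hx ↦ ?_⟩
  exact LieModule.weightSpace_le_genWeightSpace _ _ ((LieModule.mem_weightSpace _ _).mpr hx)

lemma lie_mem_weightSpaceOf {χ μ : Dual ℂ H} {x : g} {v : V}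
    (hx : ∀ h : H, ⁅(h : g), x⁆ = χ h • x) (hv : v ∈ weightSpaceOf V μ) :
    ⁅x, v⁆ ∈ weightSpaceOf V (μ + χ) := by
  rw [mem_weightSpaceOf] at hv ⊢
  intro h
  rw [leibniz_lie, hx, hv, smul_lie, lie_smul, ← add_smul, add_comm, LinearMap.add_apply]

lemma pow_toEnd_mem_weightSpaceOf {χ μ : Dual ℂ H} {x : g} {v : V}
    (hx : ∀ h : H, ⁅(h : g), x⁆ = χ h • x) (hv : v ∈ weightSpaceOf V μ) (n : ℕ) :
    (LieModule.toEnd ℂ g V x ^ n) v ∈ weightSpaceOf V (μ + n • χ) := by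
  induction n with
  | zero => simpa using hv
  | succ n ih =>
    rw [pow_succ', Module.End.mul_apply, succ_nsmul, ← add_assoc]
    exact lie_mem_weightSpaceOf hx ih

/-- An element acts locally nilpotently on a module. -/
def ActsLocallyNilpotently (V : Type*) [AddCommGroup V] [Module ℂ V] [LieRingModule g V]
    [LieModule ℂ g V] (x : g) : Prop :=
  ∀ v : V, ∃ n : ℕ, (LieModule.toEnd ℂ g V x ^ n) v = 0

/-- An `sl₂`-triple attached to a root. -/
lemma exists_isSl2Triple (α : H.root) :
    ∃ e f : g, IsSl2Triple ((rootSystem H).coroot α : g) e f ∧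
      e ∈ rootSpace H ((rootSystem H).root α) ∧ f ∈ rootSpace H (-(rootSystem H).root α : Dual ℂ H) := by
  have hα : (α : LieModule.Weight ℂ H g).IsNonZero := LieSubalgebra.isNonZero_coe_root α
  obtain ⟨h, e, f, t, he, hf⟩ := exists_isSl2Triple_of_weight_isNonZero hα
  have hh := t.h_eq_coroot hα he hf
  exact ⟨e, f, by simpa [← hh] using t, he, hf⟩

/-- If the root vectors of `α` and `-α` act locally nilpotently on `V`, then a power of one of them
maps the weight space of `μ` injectively into that of the reflection of `μ`. -/
lemma exists_pow_injective_weightSpaceOf (α : H.root)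
    (hpos : ∀ x ∈ rootSpace H ((rootSystem H).root α), ActsLocallyNilpotently V x)
    (hneg : ∀ x ∈ rootSpace H (-(rootSystem H).root α : Dual ℂ H), ActsLocallyNilpotently V x)
    {μ : Dual ℂ H} {n : ℤ} (hn : μ ((rootSystem H).coroot α) = n) :
    ∃ x : g, ∃ k : ℕ, (x ∈ rootSpace H ((rootSystem H).root α) ∨
        x ∈ rootSpace H (-(rootSystem H).root α : Dual ℂ H)) ∧
      (∀ v ∈ weightSpaceOf V μ, (LieModule.toEnd ℂ g V x ^ k) v ∈
        weightSpaceOf V ((rootSystem H).reflection α μ)) ∧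
      ∀ v ∈ weightSpaceOf V μ, (LieModule.toEnd ℂ g V x ^ k) v = 0 → v = 0 := by
  obtain ⟨e, f, t, he, hf⟩ := exists_isSl2Triple α
  have hr : (rootSystem H).reflection α μ = μ - (n : ℂ) • (rootSystem H).root α := by
    rw [RootPairing.reflection_apply, ← hn]; rfl
  -- For n = k use f^k, for n = -k use e^k and the opposite triple; local nilpotence of the other
  -- root vector gives injectivity.
  obtain ⟨k, rfl | rfl⟩ := n.eq_nat_or_neg
  · refine ⟨f, k, .inr hf, fun v hv ↦ ?_, fun v hv h0 ↦ ?_⟩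
    · have := pow_toEnd_mem_weightSpaceOf ((mem_rootSpace_iff _).mp hf) hv k
      rwa [smul_neg, ← sub_eq_add_neg, ← Nat.cast_smul_eq_nsmul ℂ, ← Int.cast_natCast, ← hr]
        at this
    · obtain ⟨m, hm⟩ := hpos e he v
      refine t.eq_zero_of_pow_toEnd_f_eq_zero m ?_ hm h0
      rw [mem_weightSpaceOf.mp hv, hn]; simp
  · refine ⟨e, k, .inl he, fun v hv ↦ ?_, fun v hv h0 ↦ ?_⟩
    · have := pow_toEnd_mem_weightSpaceOf ((mem_rootSpace_iff _).mp he) hv k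
      rwa [← Nat.cast_smul_eq_nsmul ℂ, ← Int.cast_natCast, ← sub_neg_eq_add, ← neg_smul,
        ← Int.cast_neg, ← hr] at this
    · obtain ⟨m, hm⟩ := hneg f hf v
      refine t.symm.eq_zero_of_pow_toEnd_f_eq_zero m ?_ hm h0
      rw [neg_lie, mem_weightSpaceOf.mp hv, hn]; simp

lemma multiplicity_le_reflection (α : H.root)
    (hpos : ∀ x ∈ rootSpace H ((rootSystem H).root α), ActsLocallyNilpotently V x)
    (hneg : ∀ x ∈ rootSpace H (-(rootSystem H).root α : Dual ℂ H), ActsLocallyNilpotently V x)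
    {μ : Dual ℂ H} {n : ℤ} (hn : μ ((rootSystem H).coroot α) = n) :
    multiplicity V μ ≤ multiplicity V ((rootSystem H).reflection α μ) := by
  obtain ⟨x, k, -, hmem, hinj⟩ := exists_pow_injective_weightSpaceOf α hpos hneg hn
  let φ : (weightSpaceOf V μ).toSubmodule →ₗ[ℂ]
      (weightSpaceOf V ((rootSystem H).reflection α μ)).toSubmodule :=
    (LieModule.toEnd ℂ g V x ^ k).restrict hmem
  refine LinearMap.rank_le_of_injective φ ((injective_iff_map_eq_zero φ).mpr ?_)
  rintro ⟨v, hv⟩ h0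
  exact Subtype.ext (hinj v hv (congrArg Subtype.val h0))

lemma eq_smul_of_mem_rootSpace (α : H.root) {x y : g}
    (hx : x ∈ rootSpace H ((rootSystem H).root α)) (hx0 : x ≠ 0)
    (hy : y ∈ rootSpace H ((rootSystem H).root α)) : ∃ c : ℂ, y = c • x := by
  have h1 : finrank ℂ (rootSpace H ((rootSystem H).root α)) = 1 :=
    finrank_rootSpace_eq_one _ (LieSubalgebra.isNonZero_coe_root α)
  obtain ⟨c, hc⟩ := (finrank_eq_one_iff_of_nonzero' (⟨x, hx⟩ : rootSpace H ((rootSystem H).root α))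
    (fun h ↦ hx0 (congrArg Subtype.val h))).mp h1 ⟨y, hy⟩
  exact ⟨c, (congrArg Subtype.val hc).symm⟩

lemma rootSpace_neg_root (α : H.root) :
    rootSpace H (-(rootSystem H).root α : Dual ℂ H) =
      rootSpace H ((rootSystem H).root ((rootSystem H).reflectionPerm α α)) := by
  rw [RootPairing.root_reflectionPerm, RootPairing.reflection_apply_self]

/-- In the adjoint representation a power of a root vector of ±α, which lies in 𝔨, sends a non-zero
vector of the β root space to one that spans the reflected line. -/
lemma rootSpace_le_of_reflection {𝔨 : LieSubalgebra ℂ g} (α β : H.root)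
    (hα : ∀ x ∈ rootSpace H ((rootSystem H).root α), x ∈ 𝔨)
    (hα' : ∀ x ∈ rootSpace H (-(rootSystem H).root α : Dual ℂ H), x ∈ 𝔨)
    (hβ : ∀ x ∈ rootSpace H ((rootSystem H).root β), x ∈ 𝔨) :
    ∀ x ∈ rootSpace H ((rootSystem H).root ((rootSystem H).reflectionPerm α β)), x ∈ 𝔨 := by
  have key (γ : H.root) (x : g) (hx : x ∈ rootSpace H ((rootSystem H).root γ)) :
      ActsLocallyNilpotently g x := by
    intro y
    obtain ⟨n, hn⟩ := LieModule.isNilpotent_toEnd_of_mem_rootSpace (M := g) H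
      (LieSubalgebra.isNonZero_coe_root γ) hx
    exact ⟨n, by simp [hn]⟩
  obtain ⟨n, hn⟩ := (rootSystem H).exists_value (S := ℤ) β α
  obtain ⟨x, k, hxα, hmem, hinj⟩ := exists_pow_injective_weightSpaceOf (V := g) α (key α)
    (by rw [rootSpace_neg_root]; exact key _) (μ := (rootSystem H).root β) (n := n) hn.symm
  obtain ⟨y, hy, hy0⟩ := LieModule.Weight.exists_ne_zero (β : LieModule.Weight ℂ H g)
  have hy' : y ∈ weightSpaceOf g ((rootSystem H).root β) :=
    mem_weightSpaceOf.mpr ((mem_rootSpace_iff _).mp hy)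
  have hx𝔨 : x ∈ 𝔨 := hxα.elim (hα x) (hα' x)
  have hpow : (LieModule.toEnd ℂ g g x ^ k) y ∈ 𝔨 := by
    clear hinj hmem
    induction k with
    | zero => exact hβ y hy
    | succ k ih => rw [pow_succ', Module.End.mul_apply]; exact 𝔨.lie_mem hx𝔨 ih
  intro z hz
  obtain ⟨c, rfl⟩ := eq_smul_of_mem_rootSpace _ (x := (LieModule.toEnd ℂ g g x ^ k) y)
    (by
      rw [RootPairing.root_reflectionPerm]
      exact (mem_rootSpace_iff _).mpr (mem_weightSpaceOf.mp (hmem y hy')))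
    (fun h ↦ hy0 (hinj y hy' h)) hz
  exact 𝔨.smul_mem c hpow

/-- The root spaces of the simple roots and their negatives generate `g`. -/
lemma eq_top_of_simple_rootSpace_le (b : (rootSystem H).Base) (𝔨 : LieSubalgebra ℂ g)
    (hpos : ∀ i ∈ b.support, ∀ x ∈ rootSpace H ((rootSystem H).root i), x ∈ 𝔨)
    (hneg : ∀ i ∈ b.support, ∀ x ∈ rootSpace H (-(rootSystem H).root i : Dual ℂ H), x ∈ 𝔨) : 𝔨 = ⊤ := by
  -- Both signs are carried together so that the induction is closed under negation of roots.
  have hroot (α : H.root) : (∀ x ∈ rootSpace H ((rootSystem H).root α), x ∈ 𝔨) ∧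
      (∀ x ∈ rootSpace H (-(rootSystem H).root α : Dual ℂ H), x ∈ 𝔨) := by
    have hnn (i : H.root) : rootSpace H (-(rootSystem H).root ((rootSystem H).reflectionPerm i i) : Dual ℂ H)
        = rootSpace H ((rootSystem H).root i) := by
      rw [RootPairing.root_reflectionPerm, RootPairing.reflection_apply_self, neg_neg]
    refine b.induction_reflect α (p := fun α ↦
      (∀ x ∈ rootSpace H ((rootSystem H).root α), x ∈ 𝔨) ∧
      (∀ x ∈ rootSpace H (-(rootSystem H).root α : Dual ℂ H), x ∈ 𝔨)) ?_ (fun i hi ↦ ⟨hpos i hi, hneg i hi⟩) ?_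
    · rintro i ⟨h1, h2⟩
      exact ⟨by rwa [← rootSpace_neg_root], by rwa [hnn]⟩
    · rintro i j ⟨h1, h2⟩ hj
      refine ⟨rootSpace_le_of_reflection j i (hpos j hj) (hneg j hj) h1, ?_⟩
      have h3 := rootSpace_le_of_reflection j ((rootSystem H).reflectionPerm i i) (hpos j hj)
        (hneg j hj) (by rwa [← rootSpace_neg_root])
      rwa [RootPairing.root_reflectionPerm, RootPairing.root_reflectionPerm,
        RootPairing.reflection_apply_self, map_neg, ← RootPairing.root_reflectionPerm] at h3
  have hH (h : H) : (h : g) ∈ 𝔨 := by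
    have : h ∈ (⊤ : Submodule ℂ H) := trivial
    rw [← b.span_coroot_support.trans RootPairing.IsRootSystem.span_coroot_eq_top] at this
    induction this using Submodule.span_induction with
    | zero => simp
    | add x y _ _ hx hy => simpa using 𝔨.add_mem hx hy
    | smul c x _ hx => simpa using 𝔨.smul_mem c hx
    | mem x hx =>
      obtain ⟨i, hi, rfl⟩ := hx
      obtain ⟨e, f, t, he, hf⟩ := exists_isSl2Triple i
      rw [← t.lie_e_f]
      exact 𝔨.lie_mem (hpos i hi e he) (hneg i hi f hf)
  rw [eq_top_iff]
  have hle : (H.toLieSubmodule ⊔ ⨆ α : LieModule.Weight ℂ H g, ⨆ (_ : α.IsNonZero),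
      rootSpace H α).toSubmodule ≤ 𝔨.toSubmodule := by
    simp only [LieSubmodule.sup_toSubmodule, LieSubmodule.iSup_toSubmodule, sup_le_iff,
      iSup_le_iff]
    refine ⟨fun x hx ↦ hH ⟨x, hx⟩, fun α hα x hx ↦ ?_⟩
    exact (hroot ⟨α, by simpa using hα⟩).1 x hx
  rw [cartan_sup_iSup_rootSpace_eq_top] at hle
  exact fun x _ ↦ hle (by trivial)

end ODEIM

/-! ### Highest weight modules and descendants of the highest weight vector -/

namespace ODEIM

variable {g : Type*} [LieRing g] [LieAlgebra ℂ g] [FiniteDimensional ℂ g] [IsKilling ℂ g]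
  {H : LieSubalgebra ℂ g} [H.IsCartanSubalgebra]
  {V : Type*} [AddCommGroup V] [Module ℂ V] [LieRingModule g V] [LieModule ℂ g V]
  {b : (rootSystem H).Base} {ω : Dual ℂ H} {v : V}

/-- The non-negative integral combinations of simple roots. -/
def rootCone (b : (rootSystem H).Base) : AddSubmonoid (Dual ℂ H) :=
  AddSubmonoid.closure ((rootSystem H).root '' b.support)

lemma root_mem_rootCone {i : H.root} (hi : i ∈ b.support) : (rootSystem H).root i ∈ rootCone b :=
  AddSubmonoid.subset_closure ⟨i, hi, rfl⟩

/-- A functional which is positive on the simple roots is positive on the non-zero elements of the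
root cone. -/
lemma eq_zero_or_pos_of_mem_rootCone (φ : Dual ℂ H →+ ℝ)
    (hφ : ∀ i ∈ b.support, 0 < φ ((rootSystem H).root i)) {δ : Dual ℂ H} (hδ : δ ∈ rootCone b) :
    δ = 0 ∨ 0 < φ δ := by
  induction hδ using AddSubmonoid.closure_induction with
  | mem x hx => obtain ⟨i, hi, rfl⟩ := hx; exact .inr (hφ i hi)
  | zero => exact .inl rfl
  | add x y _ _ hx hy =>
    obtain rfl | hx := hx
    · simpa using hy
    · obtain rfl | hy := hy
      · simpa using Or.inr hx
      · right; rw [map_add]; positivity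

/-- The height of a vector of the root lattice. -/
lemma exists_height (b : (rootSystem H).Base) :
    ∃ φ : Dual ℂ H →+ ℝ, ∀ i ∈ b.support, φ ((rootSystem H).root i) = 1 := by
  let f : Dual ℂ H →ₗ[ℂ] ℂ := b.toWeightBasis.constr ℂ (fun _ ↦ (1 : ℂ))
  refine ⟨Complex.reLm.toAddMonoidHom.comp f.toAddMonoidHom, fun i hi ↦ ?_⟩
  have : f ((rootSystem H).root i) = 1 := by
    have := b.toWeightBasis.constr_basis ℂ (fun _ ↦ (1 : ℂ)) ⟨i, hi⟩
    rwa [b.toWeightBasis_apply] at this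
  simp only [AddMonoidHom.comp_apply, LinearMap.toAddMonoidHom_coe, this]
  simp

lemma eq_zero_of_add_eq_zero_of_mem_rootCone {δ ε : Dual ℂ H} (hδ : δ ∈ rootCone b)
    (hε : ε ∈ rootCone b) (h : δ + ε = 0) : δ = 0 := by
  obtain ⟨φ, hφ⟩ := exists_height b
  have hpos : ∀ i ∈ b.support, 0 < φ ((rootSystem H).root i) := fun i hi ↦ by rw [hφ i hi]; exact one_pos
  obtain h1 | h1 := eq_zero_or_pos_of_mem_rootCone φ hpos hδ
  · exact h1
  obtain rfl | h2 := eq_zero_or_pos_of_mem_rootCone φ hpos hε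
  · simpa using h
  · have := congrArg φ h
    rw [map_add, map_zero] at this
    linarith

lemma apply_coroot_mem_int_of_mem_rootCone {δ : Dual ℂ H} (hδ : δ ∈ rootCone b) (j : H.root) :
    ∃ n : ℤ, δ ((rootSystem H).coroot j) = n := by
  induction hδ using AddSubmonoid.closure_induction with
  | mem x hx =>
    obtain ⟨i, hi, rfl⟩ := hx
    obtain ⟨n, hn⟩ := (rootSystem H).exists_value (S := ℤ) i j
    exact ⟨n, hn.symm⟩
  | zero => exact ⟨0, by simp⟩
  | add x y _ _ hx hy =>
    obtain ⟨m, hm⟩ := hx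
    obtain ⟨n, hn⟩ := hy
    exact ⟨m + n, by rw [LinearMap.add_apply, hm, hn, Int.cast_add]⟩

/-- `s` is obtained from `v` by applying root vectors of the negatives of simple roots of sum `δ`. -/
inductive IsDescendant (b : (rootSystem H).Base) (v : V) : Dual ℂ H → V → Prop
  | self : IsDescendant b v 0 v
  | lie {δ : Dual ℂ H} {s : V} (i : H.root) (hi : i ∈ b.support) (x : g)
    (hx : x ∈ rootSpace H (-(rootSystem H).root i : Dual ℂ H)) (hs : IsDescendant b v δ s) :
    IsDescendant b v (δ + (rootSystem H).root i) ⁅x, s⁆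

lemma IsDescendant.mem_rootCone {δ : Dual ℂ H} {s : V} (hs : IsDescendant b v δ s) :
    δ ∈ rootCone b := by
  induction hs with
  | self => exact zero_mem _
  | lie i hi x hx hs ih => exact add_mem ih (root_mem_rootCone hi)

lemma IsDescendant.mem_weightSpaceOf (hv : v ∈ weightSpaceOf V ω) {δ : Dual ℂ H} {s : V}
    (hs : IsDescendant b v δ s) : s ∈ weightSpaceOf V (ω - δ) := by
  induction hs with
  | self => simpa using hv
  | lie i hi x hx hs ih =>
    rw [← sub_sub, sub_eq_add_neg _ ((rootSystem H).root i)]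
    exact lie_mem_weightSpaceOf ((mem_rootSpace_iff _).mp hx) ih

/-- The bracket has weight α_j - α_i, which is neither zero nor a root. -/
lemma lie_eq_zero_of_simple_ne {i j : H.root} (hi : i ∈ b.support) (hj : j ∈ b.support)
    (hij : i ≠ j) {x y : g} (hx : x ∈ rootSpace H (-(rootSystem H).root i : Dual ℂ H))
    (hy : y ∈ rootSpace H ((rootSystem H).root j)) : ⁅y, x⁆ = 0 := by
  by_contra hne
  have hmem : ⁅y, x⁆ ∈ rootSpace H ((rootSystem H).root j - (rootSystem H).root i : Dual ℂ H) := by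
    refine (mem_rootSpace_iff _).mpr (mem_weightSpaceOf.mp ?_)
    rw [← lie_skew, neg_mem_iff]
    have := lie_mem_weightSpaceOf ((mem_rootSpace_iff _).mp hx)
      (mem_weightSpaceOf.mpr ((mem_rootSpace_iff _).mp hy))
    rwa [← sub_eq_add_neg] at this
  let χ : LieModule.Weight ℂ H g :=
    ⟨((rootSystem H).root j - (rootSystem H).root i : Dual ℂ H), fun h ↦ hne (by
      have h1 : ⁅y, x⁆ ∈ (⊥ : LieSubmodule ℂ H g) := h ▸ hmem
      simpa using h1)⟩
  have hχ : χ.IsNonZero := fun h0 ↦ by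
    apply hij
    apply (rootSystem H).root.injective
    have h1 : (rootSystem H).root j - (rootSystem H).root i = 0 := DFunLike.coe_injective h0
    exact (sub_eq_zero.mp h1).symm
  refine b.sub_notMem_range_root hj hi ⟨⟨χ, by simpa using hχ⟩, ?_⟩
  ext; rfl

lemma lie_mem_cartan_of_mem_rootSpace_neg {i : H.root} {x y : g}
    (hx : x ∈ rootSpace H (-(rootSystem H).root i : Dual ℂ H))
    (hy : y ∈ rootSpace H ((rootSystem H).root i)) : ⁅y, x⁆ ∈ H := by
  have h0 := lie_mem_weightSpaceOf ((mem_rootSpace_iff _).mp hy)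
    (mem_weightSpaceOf.mpr ((mem_rootSpace_iff _).mp hx))
  rw [neg_add_cancel, mem_weightSpaceOf] at h0
  have h1 := (mem_rootSpace_iff (0 : Dual ℂ H)).mpr h0
  have h2 : ⇑(0 : Dual ℂ H) = 0 := rfl
  rwa [h2, rootSpace_zero_eq] at h1

/-- The span of the descendants of a vector. -/
def descendantSpan (b : (rootSystem H).Base) (v : V) : Submodule ℂ V :=
  Submodule.span ℂ {s | ∃ δ, IsDescendant b v δ s}

lemma lie_mem_descendantSpan_of_forall {x : g}
    (hx : ∀ δ s, IsDescendant b v δ s → ⁅x, s⁆ ∈ descendantSpan b v) {u : V}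
    (hu : u ∈ descendantSpan b v) : ⁅x, u⁆ ∈ descendantSpan b v := by
  induction hu using Submodule.span_induction with
  | mem s hs => obtain ⟨δ, hs⟩ := hs; exact hx δ s hs
  | zero => simp
  | add s t _ _ hs ht => rw [lie_add]; exact add_mem hs ht
  | smul c s _ hs => rw [lie_smul]; exact Submodule.smul_mem _ c hs

lemma IsHighestWeightVector.mem_weightSpaceOf (hv : IsHighestWeightVector b ω v) :
    v ∈ weightSpaceOf V ω :=
  ODEIM.mem_weightSpaceOf.mpr hv.lie_cartan

/-- The stabilizer of the span is a subalgebra, so simple root vectors of both signs suffice.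
Lowering ones are built in; raising ones are moved to the right, leaving only Cartan elements, which
act by scalars, until they kill v. -/
lemma IsHighestWeightVector.lie_mem_descendantSpan (hv : IsHighestWeightVector b ω v) (x : g)
    {u : V} (hu : u ∈ descendantSpan b v) : ⁅x, u⁆ ∈ descendantSpan b v := by
  have hcartan (h : H) (δ : Dual ℂ H) (s : V) (hs : IsDescendant b v δ s) :
      ⁅(h : g), s⁆ ∈ descendantSpan b v := by
    rw [ODEIM.mem_weightSpaceOf.mp (hs.mem_weightSpaceOf hv.mem_weightSpaceOf)]
    exact Submodule.smul_mem _ _ (Submodule.subset_span ⟨δ, hs⟩)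
  have hneg (i : H.root) (hi : i ∈ b.support) (x : g)
      (hx : x ∈ rootSpace H (-(rootSystem H).root i : Dual ℂ H)) {u : V}
      (hu : u ∈ descendantSpan b v) : ⁅x, u⁆ ∈ descendantSpan b v :=
    lie_mem_descendantSpan_of_forall
      (fun δ s hs ↦ Submodule.subset_span ⟨_, .lie i hi x hx hs⟩) hu
  have hpos (j : H.root) (hj : j ∈ b.support) (y : g)
      (hy : y ∈ rootSpace H ((rootSystem H).root j)) (δ : Dual ℂ H) (s : V)
      (hs : IsDescendant b v δ s) : ⁅y, s⁆ ∈ descendantSpan b v := by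
    induction hs with
    | self => rw [hv.lie_simple j hj y hy]; exact zero_mem _
    | lie i hi x hx hs ih =>
      rw [leibniz_lie]
      refine add_mem ?_ (hneg i hi x hx ih)
      by_cases hij : i = j
      · subst hij
        exact hcartan ⟨_, lie_mem_cartan_of_mem_rootSpace_neg hx hy⟩ _ _ hs
      · rw [lie_eq_zero_of_simple_ne hi hj hij hx hy, zero_lie]
        exact zero_mem _
  let 𝔨 : LieSubalgebra ℂ g :=
    { carrier := {x | ∀ u ∈ descendantSpan b v, ⁅x, u⁆ ∈ descendantSpan b v}
      zero_mem' := fun u _ ↦ by simp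
      add_mem' := fun {x y} hx hy u hu ↦ by rw [add_lie]; exact add_mem (hx u hu) (hy u hu)
      smul_mem' := fun c x hx u hu ↦ by rw [smul_lie]; exact Submodule.smul_mem _ c (hx u hu)
      lie_mem' := fun {x y} hx hy u hu ↦ by
        rw [lie_lie]; exact sub_mem (hx _ (hy u hu)) (hy _ (hx u hu)) }
  have h𝔨 : 𝔨 = ⊤ := eq_top_of_simple_rootSpace_le b 𝔨
    (fun j hj y hy u hu ↦ lie_mem_descendantSpan_of_forall (hpos j hj y hy) hu)
    (fun i hi x hx u hu ↦ hneg i hi x hx hu)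
  have hx𝔨 : x ∈ 𝔨 := h𝔨 ▸ LieSubalgebra.mem_top x
  exact hx𝔨 u hu

lemma IsHighestWeightVector.descendantSpan_eq_top [LieModule.IsIrreducible ℂ g V]
    (hv : IsHighestWeightVector b ω v) : descendantSpan b v = ⊤ := by
  let N : LieSubmodule ℂ g V := { descendantSpan b v with
    lie_mem := fun {x u} hu ↦ hv.lie_mem_descendantSpan x hu }
  have hvN : v ∈ N := Submodule.subset_span ⟨0, .self⟩
  have hN : N = ⊤ := (eq_bot_or_eq_top N).resolve_left fun h ↦ hv.ne_zero (by
    rw [h] at hvN; simpa using hvN)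
  exact congrArg LieSubmodule.toSubmodule hN

/-- If every descendant of `v` has weight different from `μ` or is proportional to `u`, then the
weight space of `μ` is contained in the line spanned by `u`. -/
lemma IsHighestWeightVector.weightSpaceOf_le_span [LieModule.IsIrreducible ℂ g V]
    (hv : IsHighestWeightVector b ω v) {μ : Dual ℂ H} {u : V} (hu : u ∈ weightSpaceOf V μ)
    (h : ∀ δ s, IsDescendant b v δ s → ω - δ = μ → s ∈ Submodule.span ℂ {u}) :
    (weightSpaceOf V μ).toSubmodule ≤ Submodule.span ℂ {u} := by
  have hind := (LieModule.iSupIndep_genWeightSpace ℂ H V).mono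
    (fun χ ↦ LieModule.weightSpace_le_genWeightSpace V χ)
  have hdisj := hind (⇑μ)
  have htop : descendantSpan b v ≤ Submodule.span ℂ {u} ⊔
      (⨆ χ, ⨆ (_ : χ ≠ ⇑μ), LieModule.weightSpace V χ : LieSubmodule ℂ H V).toSubmodule := by
    refine Submodule.span_le.mpr ?_
    rintro s ⟨δ, hs⟩
    by_cases hδ : ω - δ = μ
    · exact Submodule.mem_sup_left (h δ s hs hδ)
    · refine Submodule.mem_sup_right ?_
      have hle : LieModule.weightSpace V (⇑(ω - δ)) ≤
          (⨆ χ, ⨆ (_ : χ ≠ ⇑μ), LieModule.weightSpace V χ : LieSubmodule ℂ H V) :=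
        le_iSup₂_of_le (⇑(ω - δ)) (fun h0 ↦ hδ (DFunLike.coe_injective h0)) le_rfl
      exact hle (hs.mem_weightSpaceOf hv.mem_weightSpaceOf)
  rw [hv.descendantSpan_eq_top] at htop
  intro w hw
  -- The component z lies in V_μ and in the sum of the other weight spaces, hence vanishes.
  obtain ⟨y, hy, z, hz, rfl⟩ := Submodule.mem_sup.mp (htop (Submodule.mem_top (x := w)))
  have hyμ : y ∈ weightSpaceOf V μ := by
    obtain ⟨c, rfl⟩ := Submodule.mem_span_singleton.mp hy
    exact (weightSpaceOf V μ).smul_mem c hu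
  have hzμ : z ∈ weightSpaceOf V μ := by simpa using sub_mem hw hyμ
  have hz0 : z ∈ (⊥ : LieSubmodule ℂ H V) := by
    rw [← disjoint_iff.mp hdisj]; exact ⟨hzμ, hz⟩
  rw [LieSubmodule.mem_bot] at hz0
  rwa [hz0, add_zero]

lemma IsHighestWeightVector.exists_isDescendant_of_mem_weights [LieModule.IsIrreducible ℂ g V]
    (hv : IsHighestWeightVector b ω v) {μ : Dual ℂ H} (hμ : μ ∈ weights H V) :
    ∃ δ s, IsDescendant b v δ s ∧ s ≠ 0 ∧ μ = ω - δ := by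
  by_contra! hcon
  refine hμ ((LieSubmodule.eq_bot_iff _).mpr fun u hu ↦ ?_)
  -- With u = 0 the bounding line degenerates to zero.
  have := hv.weightSpaceOf_le_span (μ := μ) (u := 0) (zero_mem _) (fun δ s hs h ↦ by
    by_contra hne
    exact hcon δ s hs (fun h0 ↦ hne (by simp [h0])) h.symm) hu
  simpa using this

lemma IsHighestWeightVector.exists_rootCone_of_mem_weights [LieModule.IsIrreducible ℂ g V]
    (hv : IsHighestWeightVector b ω v) {μ : Dual ℂ H} (hμ : μ ∈ weights H V) :
    ∃ δ ∈ rootCone b, μ = ω - δ := by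
  obtain ⟨δ, s, hs, -, h⟩ := hv.exists_isDescendant_of_mem_weights hμ
  exact ⟨δ, hs.mem_rootCone, h⟩

lemma mem_weights_of_mem {μ : Dual ℂ H} {u : V} (hu : u ∈ weightSpaceOf V μ) (h0 : u ≠ 0) :
    μ ∈ weights H V := fun h ↦ h0 (by
  have : u ∈ (⊥ : LieSubmodule ℂ H V) := h ▸ hu
  simpa using this)

lemma multiplicity_eq_one_of_le_span {μ : Dual ℂ H} {u : V} (hu : u ∈ weightSpaceOf V μ)
    (h0 : u ≠ 0) (h : (weightSpaceOf V μ).toSubmodule ≤ Submodule.span ℂ {u}) :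
    multiplicity V μ = 1 := by
  have : (weightSpaceOf V μ).toSubmodule = Submodule.span ℂ {u} :=
    le_antisymm h ((Submodule.span_singleton_le_iff_mem _ _).mpr hu)
  change Module.rank ℂ (weightSpaceOf V μ).toSubmodule = 1
  rw [this, rank_submodule_eq_one_iff]
  exact ⟨u, Submodule.mem_span_singleton_self u, h0, le_rfl⟩

lemma IsHighestWeightVector.multiplicity_eq_one [LieModule.IsIrreducible ℂ g V]
    (hv : IsHighestWeightVector b ω v) : multiplicity V ω = 1 := by
  refine multiplicity_eq_one_of_le_span hv.mem_weightSpaceOf hv.ne_zero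
    (hv.weightSpaceOf_le_span hv.mem_weightSpaceOf fun δ s hs hδ ↦ ?_)
  have hδ0 : δ = 0 := by simpa using hδ
  cases hs with
  | self => exact Submodule.mem_span_singleton_self v
  | lie i hi x hx hs =>
    have := eq_zero_of_add_eq_zero_of_mem_rootCone (root_mem_rootCone hi) hs.mem_rootCone
      ((add_comm _ _).trans hδ0)
    exact absurd this ((rootSystem H).ne_zero i)

/-- The vector `f_i ^ (n + 1) v` vanishes in the irreducible module, where `n = ω (h_i)`. -/
lemma IsHighestWeightVector.pow_succ_toEnd_eq_zero [LieModule.IsIrreducible ℂ g V]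
    (hv : IsHighestWeightVector b ω v) {i : H.root} (hi : i ∈ b.support) {n : ℕ}
    (hn : ω ((rootSystem H).coroot i) = n) {f : g}
    (hf : f ∈ rootSpace H (-(rootSystem H).root i : Dual ℂ H)) :
    (LieModule.toEnd ℂ g V f ^ (n + 1)) v = 0 := by
  by_cases hf0 : f = 0
  · simp [hf0]
  obtain ⟨e, f', t, he, hf'⟩ := exists_isSl2Triple i
  rw [rootSpace_neg_root] at hf hf'
  obtain ⟨c, rfl⟩ := eq_smul_of_mem_rootSpace _ hf' t.f_ne_zero hf
  rw [← rootSpace_neg_root] at hf hf'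
  suffices (LieModule.toEnd ℂ g V f' ^ (n + 1)) v = 0 by
    rw [map_smul, smul_pow, LinearMap.smul_apply, this, smul_zero]
  by_contra hne
  have P : IsSl2Triple.HasPrimitiveVectorWith t v (n : ℂ) :=
    ⟨hv.ne_zero, by rw [hv.lie_cartan, hn], hv.lie_simple i hi e he⟩
  have hmem := pow_toEnd_mem_weightSpaceOf ((mem_rootSpace_iff _).mp hf') hv.mem_weightSpaceOf
    (n + 1)
  -- The scalar (n + 1)(n - n) makes e_i kill this vector; the other e_j commute with f_i. All
  -- weights, ω included, would then lie below ω - (n + 1)α_i.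
  have hu : IsHighestWeightVector b (ω + (n + 1) • -(rootSystem H).root i)
      ((LieModule.toEnd ℂ g V f' ^ (n + 1)) v) := by
    refine ⟨hne, ODEIM.mem_weightSpaceOf.mp hmem, fun j hj y hy ↦ ?_⟩
    by_cases hij : i = j
    · subst hij
      obtain ⟨c, rfl⟩ := eq_smul_of_mem_rootSpace _ he t.e_ne_zero hy
      rw [smul_lie, P.lie_e_pow_succ_toEnd_f]
      simp
    · have hcomm : Commute (LieModule.toEnd ℂ g V y) (LieModule.toEnd ℂ g V f') := by
        ext w
        simp [leibniz_lie y f' w, lie_eq_zero_of_simple_ne hi hj hij hf' hy]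
      rw [← LieModule.toEnd_apply_apply ℂ, ← Module.End.mul_apply, (hcomm.pow_right _).eq,
        Module.End.mul_apply, LieModule.toEnd_apply_apply, hv.lie_simple j hj y hy, map_zero]
  obtain ⟨δ, hδ, h⟩ := hu.exists_rootCone_of_mem_weights
    (mem_weights_of_mem hv.mem_weightSpaceOf hv.ne_zero)
  have h1 : (n + 1) • (rootSystem H).root i + δ = 0 := by
    rw [smul_neg, ← sub_eq_add_neg, sub_sub, eq_comm, sub_eq_self] at h
    exact h
  have h2 := eq_zero_of_add_eq_zero_of_mem_rootCone
    (AddSubmonoid.nsmul_mem _ (root_mem_rootCone hi) _) hδ h1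
  rw [← Nat.cast_smul_eq_nsmul ℂ, smul_eq_zero] at h2
  exact h2.elim (by norm_cast) ((rootSystem H).ne_zero i)

/-- An ad-nilpotent element which is nilpotent on one non-zero vector of an irreducible module acts
locally nilpotently on the module. -/
lemma actsLocallyNilpotently_of_isNilpotent [LieModule.IsIrreducible ℂ g V]
    {x : g} (hx : IsNilpotent (LieModule.toEnd ℂ g g x)) {u : V} (hu0 : u ≠ 0) {n : ℕ}
    (hu : (LieModule.toEnd ℂ g V x ^ n) u = 0) : ActsLocallyNilpotently V x := by
  have hmem (w : V) : w ∈ (LieModule.toEnd ℂ g V x).maxGenEigenspace 0 ↔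
      ∃ n : ℕ, (LieModule.toEnd ℂ g V x ^ n) w = 0 := by
    simp [Module.End.mem_maxGenEigenspace]
  -- Stable under `g`: as ad x is nilpotent, every y is in the generalized 0-eigenspace of ad x, and
  -- generalized eigenvalues add.
  let N : LieSubmodule ℂ g V := { (LieModule.toEnd ℂ g V x).maxGenEigenspace 0 with
    lie_mem := fun {y w} hw ↦ by
      have hy : y ∈ (LieModule.toEnd ℂ g g x).maxGenEigenspace 0 := by
        obtain ⟨k, hk⟩ := hx
        rw [Module.End.mem_maxGenEigenspace]
        exact ⟨k, by simp [hk]⟩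
      have := LieModule.lie_mem_maxGenEigenspace_toEnd (R := ℂ) (L := g) (M := V) hy hw
      rwa [add_zero] at this }
  have huN : u ∈ N := (hmem u).mpr ⟨n, hu⟩
  have hN : N = ⊤ := (eq_bot_or_eq_top N).resolve_left fun h ↦ hu0 (by
    rw [h] at huN; simpa using huN)
  intro w
  have hw : w ∈ N := hN ▸ LieSubmodule.mem_top w
  exact (hmem w).mp hw

end ODEIM

/-! ### Weyl group: simple reflections, exchange property, positive coroots -/

namespace RootPairing

section General

variable {ι R M N : Type*} [CommRing R] [AddCommGroup M] [Module R M] [AddCommGroup N] [Module R N]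
  {P : RootPairing ι R M N}

lemma root_weylGroup_smul (w : P.weylGroup) (i : ι) : P.root (w • i) = w • P.root i :=
  Equiv.root_indexEquiv_eq_smul P i (w : P.Aut)

lemma weylGroup_ext {w w' : P.weylGroup} (h : ∀ m : M, w • m = w' • m) : w = w' :=
  Subtype.ext (Equiv.weightHom_injective P (LinearEquiv.ext h))

lemma ofIdx_smul_index (i j : ι) : weylGroup.ofIdx P i • j = P.reflectionPerm i j := rfl

lemma ofIdx_smul_weight (i : ι) (m : M) : weylGroup.ofIdx P i • m = P.reflection i m := rfl

lemma ofIdx_mul_self (i : ι) : weylGroup.ofIdx P i * weylGroup.ofIdx P i = 1 :=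
  weylGroup_ext fun m ↦ by
    rw [mul_smul, ofIdx_smul_weight, ofIdx_smul_weight, one_smul, reflection_same]

lemma toLinearMap_weylGroup_smul (w : P.weylGroup) (m : M) (i : ι) :
    P.toLinearMap (w • m) (P.coroot (w • i)) = P.toLinearMap m (P.coroot i) := by
  obtain ⟨w, hw⟩ := w
  induction hw using weylGroup.induction generalizing m i with
  | mem j =>
    change P.toLinearMap (P.reflection j m) (P.coroot (P.reflectionPerm j i)) = _
    rw [coroot_reflectionPerm, reflection_apply, coreflection_apply]
    simp
    ring
  | one =>
    change P.toLinearMap ((1 : P.weylGroup) • m) (P.coroot ((1 : P.weylGroup) • i)) = _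
    rw [one_smul, one_smul]
  | mul x y hx hy h1 h2 =>
    rw [← Submonoid.mk_mul_mk _ _ _ hx hy, mul_smul, mul_smul, h1, h2]

lemma weylGroup_smul_reflectionPerm_self (w : P.weylGroup) (i : ι) :
    w • P.reflectionPerm i i = P.reflectionPerm (w • i) (w • i) := by
  apply P.root.injective
  rw [root_weylGroup_smul, root_reflectionPerm, reflection_apply_self, smul_neg,
    root_reflectionPerm, reflection_apply_self, root_weylGroup_smul]

lemma weylGroup_mul_ofIdx (w : P.weylGroup) (i : ι) :
    w * weylGroup.ofIdx P i = weylGroup.ofIdx P (w • i) * w := by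
  refine weylGroup_ext fun m ↦ ?_
  rw [mul_smul, mul_smul, ofIdx_smul_weight, ofIdx_smul_weight, reflection_apply, reflection_apply,
    root_weylGroup_smul]
  have h := toLinearMap_weylGroup_smul w m i
  simp only [coroot', LinearMap.flip_apply]
  rw [h, smul_sub, smul_comm]

end General

section Base

variable {ι R M N : Type*} [CommRing R] [IsDomain R] [CharZero R] [Finite ι]
  [AddCommGroup M] [Module R M] [AddCommGroup N] [Module R N]
  {P : RootPairing ι R M N} [P.IsCrystallographic] [P.IsReduced] (b : P.Base)

/-- The roots span, so an element is determined by its permutation of the finitely many roots. -/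
lemma finite_weylGroup [P.IsRootSystem] : Finite P.weylGroup := by
  refine Finite.of_injective (fun (w : P.weylGroup) (i : ι) ↦ w • i) fun w w' h ↦ ?_
  refine weylGroup_ext fun m ↦ ?_
  have hm : m ∈ Submodule.span R (Set.range P.root) := by
    rw [IsRootSystem.span_root_eq_top]; trivial
  induction hm using Submodule.span_induction with
  | mem x hx =>
    obtain ⟨i, rfl⟩ := hx
    rw [← root_weylGroup_smul, ← root_weylGroup_smul]
    exact congrArg P.root (congrFun h i)
  | zero => simp
  | add x y _ _ hx hy => rw [smul_add, smul_add, hx, hy]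
  | smul c x _ hx => rw [smul_comm, smul_comm w', hx]

/-- The Weyl group is generated by the simple reflections. -/
lemma Base.closure_ofIdx_eq_top :
    Submonoid.closure (weylGroup.ofIdx P '' b.support) = ⊤ := by
  have hidx (i : ι) : weylGroup.ofIdx P i ∈ Submonoid.closure (weylGroup.ofIdx P '' b.support) := by
    refine b.induction_reflect i (p := fun i ↦ weylGroup.ofIdx P i ∈
      Submonoid.closure (weylGroup.ofIdx P '' b.support)) ?_
      (fun i hi ↦ Submonoid.subset_closure ⟨i, hi, rfl⟩) ?_
    · intro i hi
      have := weylGroup_mul_ofIdx (weylGroup.ofIdx P i) i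
      have h1 : weylGroup.ofIdx P (P.reflectionPerm i i) = weylGroup.ofIdx P i :=
        mul_right_cancel this.symm
      rwa [h1]
    · intro i j hi hj
      have hj' : weylGroup.ofIdx P j ∈ Submonoid.closure (weylGroup.ofIdx P '' b.support) :=
        Submonoid.subset_closure ⟨j, hj, rfl⟩
      have h1 : weylGroup.ofIdx P (P.reflectionPerm j i) =
          weylGroup.ofIdx P j * weylGroup.ofIdx P i * weylGroup.ofIdx P j := by
        rw [weylGroup_mul_ofIdx (weylGroup.ofIdx P j) i, mul_assoc, ofIdx_mul_self, mul_one]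
        rfl
      rw [h1]
      exact mul_mem (mul_mem hj' hi) hj'
  rw [eq_top_iff]
  rintro ⟨w, hw⟩ -
  induction hw using weylGroup.induction with
  | mem i => exact hidx i
  | one => exact one_mem _
  | mul x y hx hy h1 h2 => exact mul_mem h1 h2

/-- The exchange property: if a product of simple reflections maps a simple root to a negative root
then its product with the corresponding reflection is a shorter product. -/
lemma Base.exists_shorter_word (l : List ι) (hl : ∀ j ∈ l, j ∈ b.support) {i : ι}
    (hi : i ∈ b.support) (hneg : ¬ b.IsPos ((l.map (weylGroup.ofIdx P)).prod • i)) :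
    ∃ l' : List ι, (∀ j ∈ l', j ∈ b.support) ∧ l'.length + 1 = l.length ∧
      (l.map (weylGroup.ofIdx P)).prod * weylGroup.ofIdx P i =
        (l'.map (weylGroup.ofIdx P)).prod := by
  induction l with
  | nil =>
    rw [List.map_nil, List.prod_nil, one_smul] at hneg
    exact absurd (Base.isPos_of_mem_support hi) hneg
  | cons j l ih =>
    have hj : j ∈ b.support := hl j (by simp)
    have hl' : ∀ k ∈ l, k ∈ b.support := fun k hk ↦ hl k (by simp [hk])
    rw [List.map_cons, List.prod_cons] at hneg ⊢
    -- s_j makes no positive root negative except α_j. If the tail u keeps α_i positive, then u α_i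
    -- = α_j, so s_j u s_i = s_j s_j u = u.
    by_cases hpos : b.IsPos ((l.map (weylGroup.ofIdx P)).prod • i)
    · have hij : (l.map (weylGroup.ofIdx P)).prod • i = j := by
        by_contra hne
        rw [mul_smul, ofIdx_smul_index] at hneg
        exact hneg (hpos.reflectionPerm hj hne)
      refine ⟨l, hl', by simp, ?_⟩
      rw [mul_assoc, weylGroup_mul_ofIdx, hij, ← mul_assoc, ofIdx_mul_self, one_mul]
    · obtain ⟨l', h1, h2, h3⟩ := ih hl' hpos
      exact ⟨j :: l', by simpa [hj] using h1, by simp [h2],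
        by rw [mul_assoc, h3, List.map_cons, List.prod_cons]⟩

/-- An element of the Weyl group which maps the simple roots to positive roots is trivial. -/
lemma Base.eq_one_of_forall_isPos_smul (w : P.weylGroup)
    (hw : ∀ i ∈ b.support, b.IsPos (w • i)) : w = 1 := by
  classical
  have hex : ∃ n : ℕ, ∃ l : List ι, (∀ j ∈ l, j ∈ b.support) ∧ l.length = n ∧
      (l.map (weylGroup.ofIdx P)).prod = w := by
    have hmem : w ∈ Submonoid.closure (weylGroup.ofIdx P '' b.support) := by
      rw [b.closure_ofIdx_eq_top]; trivial
    clear hw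
    induction hmem using Submonoid.closure_induction_left with
    | one => exact ⟨0, [], by simp, rfl, rfl⟩
    | mul_left x hx y hy ih =>
      obtain ⟨j, hj, rfl⟩ := hx
      obtain ⟨-, l, hl, -, rfl⟩ := ih
      exact ⟨_, j :: l, by simpa using ⟨hj, hl⟩, rfl, by simp⟩
  -- Take a shortest word. If it ends in s_i, its prefix sends α_i to a negative root, and exchange
  -- gives a word shorter by two.
  obtain ⟨l, hl, hlen, rfl⟩ := Nat.find_spec hex
  obtain rfl | ⟨l, i, rfl⟩ := l.eq_nil_or_concat'
  · rfl
  have hi : i ∈ b.support := hl i (by simp)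
  have hl' : ∀ k ∈ l, k ∈ b.support := fun k hk ↦ hl k (by simp [hk])
  have hprod : ((l ++ [i]).map (weylGroup.ofIdx P)).prod =
      (l.map (weylGroup.ofIdx P)).prod * weylGroup.ofIdx P i := by simp
  have hneg : ¬ b.IsPos ((l.map (weylGroup.ofIdx P)).prod • i) := by
    have h1 := hw i hi
    rw [hprod, mul_smul, ofIdx_smul_index, weylGroup_smul_reflectionPerm_self] at h1
    exact (Base.IsPos.neg_iff_not b _).mp h1
  obtain ⟨l', h1, h2, h3⟩ := b.exists_shorter_word l hl' hi hneg
  refine absurd hlen (ne_of_gt ?_)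
  refine lt_of_le_of_lt (Nat.find_min' hex ⟨l', h1, rfl, by rw [hprod, h3]⟩) ?_
  rw [List.length_append, ← h2, List.length_singleton]
  lia

lemma Base.isPos_reflectionPerm_iff {i j : ι} (hj : j ∈ b.support) (hij : i ≠ j)
    (hij' : i ≠ P.reflectionPerm j j) : b.IsPos (P.reflectionPerm j i) ↔ b.IsPos i := by
  refine ⟨fun h ↦ ?_, fun h ↦ h.reflectionPerm hj hij⟩
  have := h.reflectionPerm hj (fun h' ↦ hij' (by
    rw [← P.reflectionPerm_self j i, h']))
  rwa [reflectionPerm_self] at this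

variable [Module.IsTorsionFree R M] [Module.IsTorsionFree R N]

/-- A root is positive if and only if its coroot is. -/
lemma Base.isPos_flip_iff (i : ι) : b.flip.IsPos i ↔ b.IsPos i := by
  have hneg (c : P.Base) (i : ι) : c.IsPos (P.reflectionPerm i i) ↔ ¬ c.IsPos i :=
    Base.IsPos.neg_iff_not c i
  have hneg' (i : ι) : b.flip.IsPos (P.reflectionPerm i i) ↔ ¬ b.flip.IsPos i :=
    Base.IsPos.neg_iff_not b.flip i
  refine b.induction_reflect i (p := fun i ↦ b.flip.IsPos i ↔ b.IsPos i) ?_ ?_ ?_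
  · intro i hi
    rw [hneg, hneg', hi]
  · intro i hi
    exact iff_of_true (Base.isPos_of_mem_support (b := b.flip) hi) (Base.isPos_of_mem_support hi)
  · intro i j hi hj
    by_cases h1 : i = j
    · subst h1
      rw [hneg, hneg', hi]
    by_cases h2 : i = P.reflectionPerm j j
    · rw [h2, reflectionPerm_self]
      exact iff_of_true (Base.isPos_of_mem_support (b := b.flip) hj) (Base.isPos_of_mem_support hj)
    · rw [b.isPos_reflectionPerm_iff hj h1 h2, ← hi]
      exact b.flip.isPos_reflectionPerm_iff hj h1 h2

lemma Base.root_mem_closure_of_isPos {i : ι} (hi : b.IsPos i) :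
    P.root i ∈ AddSubmonoid.closure (P.root '' b.support) := by
  refine hi.induction_on_add (p := fun i ↦ P.root i ∈ AddSubmonoid.closure (P.root '' b.support))
    (fun j hj ↦ AddSubmonoid.subset_closure ⟨j, hj, rfl⟩) fun i j k hk h1 hj ↦ ?_
  rw [hk]
  exact add_mem h1 (AddSubmonoid.subset_closure ⟨j, hj, rfl⟩)

lemma Base.coroot_mem_closure_of_isPos {i : ι} (hi : b.IsPos i) :
    P.coroot i ∈ AddSubmonoid.closure (P.coroot '' b.support) :=
  b.flip.root_mem_closure_of_isPos ((b.isPos_flip_iff i).mpr hi)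

end Base

end RootPairing

/-! ### Weyl invariance of multiplicities -/

namespace ODEIM

variable {g : Type*} [LieRing g] [LieAlgebra ℂ g] [FiniteDimensional ℂ g] [IsKilling ℂ g]
  {H : LieSubalgebra ℂ g} [H.IsCartanSubalgebra]
  {V : Type*} [AddCommGroup V] [Module ℂ V] [LieRingModule g V] [LieModule ℂ g V]
  {b : (rootSystem H).Base} {ω : Dual ℂ H} {v : V}

section Multiplicity

lemma mem_weights_iff_multiplicity_ne_zero {μ : Dual ℂ H} :
    μ ∈ weights H V ↔ multiplicity V μ ≠ 0 := by
  refine not_congr ?_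
  change weightSpaceOf V μ = ⊥ ↔ Module.rank ℂ (weightSpaceOf V μ).toSubmodule = 0
  rw [Submodule.rank_eq_zero, LieSubmodule.toSubmodule_eq_bot]

variable [LieModule.IsIrreducible ℂ g V]

lemma IsHighestWeightVector.multiplicity_le_simple_reflection (hv : IsHighestWeightVector b ω v)
    (hω : IsDominantIntegral b ω) {i : H.root} (hi : i ∈ b.support) (μ : Dual ℂ H) :
    multiplicity V μ ≤ multiplicity V ((rootSystem H).reflection i μ) := by
  -- Integrality of μ(h_i) is available only when μ is a weight; otherwise the left side is zero.
  by_cases hμ : μ ∈ weights H V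
  · obtain ⟨δ, hδ, rfl⟩ := hv.exists_rootCone_of_mem_weights hμ
    obtain ⟨m, hm⟩ := hω i hi
    obtain ⟨k, hk⟩ := apply_coroot_mem_int_of_mem_rootCone hδ i
    refine multiplicity_le_reflection i (fun x hx ↦ ?_) (fun x hx ↦ ?_) (n := m - k)
      (by rw [LinearMap.sub_apply, hm, hk]; simp)
    · exact actsLocallyNilpotently_of_isNilpotent
        (LieModule.isNilpotent_toEnd_of_mem_rootSpace (M := g) H
          (LieSubalgebra.isNonZero_coe_root i) hx)
        hv.ne_zero (n := 1) (by simpa using hv.lie_simple i hi x hx)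
    · have hvx := hv.pow_succ_toEnd_eq_zero hi hm hx
      rw [rootSpace_neg_root] at hx
      exact actsLocallyNilpotently_of_isNilpotent
        (LieModule.isNilpotent_toEnd_of_mem_rootSpace (M := g) H
          (LieSubalgebra.isNonZero_coe_root _) hx)
        hv.ne_zero hvx
  · rw [mem_weights_iff_multiplicity_ne_zero, not_not] at hμ
    rw [hμ]
    exact zero_le

lemma IsHighestWeightVector.multiplicity_weylGroup_smul (hv : IsHighestWeightVector b ω v)
    (hω : IsDominantIntegral b ω) (w : (rootSystem H).weylGroup) (μ : Dual ℂ H) :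
    multiplicity V (w • μ) = multiplicity V μ := by
  have hle (w : (rootSystem H).weylGroup) (μ : Dual ℂ H) :
      multiplicity V μ ≤ multiplicity V (w • μ) := by
    have hw : w ∈ Submonoid.closure (RootPairing.weylGroup.ofIdx (rootSystem H) '' b.support) := by
      rw [b.closure_ofIdx_eq_top]; trivial
    induction hw using Submonoid.closure_induction generalizing μ with
    | mem x hx =>
      obtain ⟨i, hi, rfl⟩ := hx
      exact hv.multiplicity_le_simple_reflection hω hi μ
    | one => rw [one_smul]
    | mul x y _ _ hx hy => rw [mul_smul]; exact (hy μ).trans (hx _)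
  refine le_antisymm ?_ (hle w μ)
  simpa using hle w⁻¹ (w • μ)

lemma IsHighestWeightVector.weylGroup_smul_mem_weights_iff (hv : IsHighestWeightVector b ω v)
    (hω : IsDominantIntegral b ω) (w : (rootSystem H).weylGroup) (μ : Dual ℂ H) :
    w • μ ∈ weights H V ↔ μ ∈ weights H V := by
  simp_rw [mem_weights_iff_multiplicity_ne_zero, hv.multiplicity_weylGroup_smul hω]

end Multiplicity

/-! ### The two top weights of a fundamental representation -/

section FundamentalWeight

lemma fundamentalWeight_self (i : b.support) :
    fundamentalWeight b i ((rootSystem H).coroot i) = 1 := by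
  rw [fundamentalWeight, Basis.coord_apply, b.toCoweightBasis_repr_coroot, Finsupp.single_eq_same]

lemma fundamentalWeight_of_ne (i : b.support) {j : H.root} (hj : j ∈ b.support) (hij : j ≠ i) :
    fundamentalWeight b i ((rootSystem H).coroot j) = 0 := by
  rw [fundamentalWeight, Basis.coord_apply, b.toCoweightBasis_repr_coroot ⟨j, hj⟩,
    Finsupp.single_eq_of_ne]
  rintro rfl
  exact hij rfl

lemma isDominantIntegral_fundamentalWeight (i : b.support) :
    IsDominantIntegral b (fundamentalWeight b i) := by
  intro j hj
  by_cases hij : j = i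
  · exact ⟨1, by rw [hij, fundamentalWeight_self, Nat.cast_one]⟩
  · exact ⟨0, by rw [fundamentalWeight_of_ne i hj hij, Nat.cast_zero]⟩

variable [LieModule.IsIrreducible ℂ g V] {i : b.support}

/-- The first lowering operator must belong to α_i, since the others kill v; later ones only enlarge
ε. The clause for ε = 0 serves the multiplicity count. -/
lemma IsDescendant.fundamentalWeight_cases
    (hv : IsHighestWeightVector b (fundamentalWeight b i) v) {δ : Dual ℂ H} {s : V}
    (hs : IsDescendant b v δ s) : s = 0 ∨ (δ = 0 ∧ s = v) ∨
      ∃ ε ∈ rootCone b, δ = (rootSystem H).root i + ε ∧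
        (ε = 0 → ∃ x ∈ rootSpace H (-(rootSystem H).root i : Dual ℂ H), s = ⁅x, v⁆) := by
  induction hs with
  | self => exact .inr (.inl ⟨rfl, rfl⟩)
  | lie j hj x hx hs ih =>
    obtain rfl | ⟨rfl, rfl⟩ | ⟨ε, hε, rfl, -⟩ := ih
    · exact .inl (lie_zero x)
    · by_cases hij : j = i
      · subst hij
        exact .inr (.inr ⟨0, zero_mem _, by rw [zero_add, add_zero], fun _ ↦ ⟨x, hx, rfl⟩⟩)
      · left
        simpa using hv.pow_succ_toEnd_eq_zero hj (n := 0)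
          (by rw [fundamentalWeight_of_ne i hj hij, Nat.cast_zero]) hx
    · refine .inr (.inr ⟨ε + (rootSystem H).root j, add_mem hε (root_mem_rootCone hj),
        add_assoc _ _ _, fun h ↦ ?_⟩)
      have := eq_zero_of_add_eq_zero_of_mem_rootCone (root_mem_rootCone hj) hε
        ((add_comm _ _).trans h)
      exact absurd this ((rootSystem H).ne_zero j)

lemma IsHighestWeightVector.eq_or_of_mem_weights_fundamentalWeight
    (hv : IsHighestWeightVector b (fundamentalWeight b i) v) {μ : Dual ℂ H}
    (hμ : μ ∈ weights H V) : μ = fundamentalWeight b i ∨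
      ∃ ε ∈ rootCone b, μ = fundamentalWeight b i - (rootSystem H).root i - ε := by
  obtain ⟨δ, s, hs, hs0, rfl⟩ := hv.exists_isDescendant_of_mem_weights hμ
  obtain h | ⟨rfl, -⟩ | ⟨ε, hε, rfl, -⟩ := hs.fundamentalWeight_cases hv
  · exact absurd h hs0
  · exact .inl (sub_zero _)
  · exact .inr ⟨ε, hε, (sub_sub _ _ _).symm⟩

/-- The vector f_i v is non-zero because e_i f_i v = h_i v = v. -/
lemma IsHighestWeightVector.multiplicity_fundamentalWeight_sub_root
    (hv : IsHighestWeightVector b (fundamentalWeight b i) v) :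
    multiplicity V (fundamentalWeight b i - (rootSystem H).root i) = 1 := by
  obtain ⟨e, f, t, he, hf⟩ := exists_isSl2Triple (i : H.root)
  have hmem : ⁅f, v⁆ ∈ weightSpaceOf V (fundamentalWeight b i - (rootSystem H).root i) := by
    rw [sub_eq_add_neg]
    exact lie_mem_weightSpaceOf ((mem_rootSpace_iff _).mp hf) hv.mem_weightSpaceOf
  have hne : ⁅f, v⁆ ≠ 0 := fun h0 ↦ hv.ne_zero (by
    have h1 := leibniz_lie e f v
    rwa [h0, lie_zero, t.lie_e_f, hv.lie_cartan, fundamentalWeight_self, one_smul,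
      hv.lie_simple i i.2 e he, lie_zero, add_zero, eq_comm] at h1)
  refine multiplicity_eq_one_of_le_span hmem hne (hv.weightSpaceOf_le_span hmem ?_)
  intro δ s hs hδ
  rw [sub_right_inj] at hδ
  obtain rfl | ⟨rfl, -⟩ | ⟨ε, hε, rfl, hx⟩ := hs.fundamentalWeight_cases hv
  · exact zero_mem _
  · exact absurd hδ.symm ((rootSystem H).ne_zero _)
  · obtain ⟨x, hx', rfl⟩ := hx (by simpa using hδ)
    clear hx
    rw [rootSpace_neg_root] at hx' hf
    obtain ⟨c, rfl⟩ := eq_smul_of_mem_rootSpace _ hf t.f_ne_zero hx'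
    exact Submodule.mem_span_singleton.mpr ⟨c, (smul_lie c f v).symm⟩

end FundamentalWeight

/-! ### The Weyl group element associated with ℓ -/

section Chamber

variable {ℓ : H} {w : (rootSystem H).weylGroup}

lemma weylGroup_smul_apply_coroot (w : (rootSystem H).weylGroup) (μ : Dual ℂ H) (i : H.root) :
    (w • μ) ((rootSystem H).coroot (w • i)) = μ ((rootSystem H).coroot i) :=
  RootPairing.toLinearMap_weylGroup_smul w μ i

/-- The functional `μ ↦ Re (w μ)(ℓ)`. -/
noncomputable def reEval (ℓ : H) (w : (rootSystem H).weylGroup) : Dual ℂ H →+ ℝ where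
  toFun μ := ((w • μ) ℓ).re
  map_zero' := by simp
  map_add' := by simp

lemma reEval_apply (μ : Dual ℂ H) : reEval ℓ w μ = ((w • μ) ℓ).re := rfl

lemma reEval_root (i : H.root) : reEval ℓ w ((rootSystem H).root i) =
    ((rootSystem H).root (w • i) ℓ).re := by
  rw [reEval_apply, RootPairing.root_weylGroup_smul]

/-- The weight taking the value one on each simple coroot. -/
noncomputable def weylVector (b : (rootSystem H).Base) : Dual ℂ H :=
  b.toCoweightBasis.constr ℂ (fun _ ↦ (1 : ℂ))

lemma weylVector_apply_coroot {i : H.root} (hi : i ∈ b.support) :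
    weylVector b ((rootSystem H).coroot i) = 1 := by
  have := b.toCoweightBasis.constr_basis ℂ (fun _ ↦ (1 : ℂ)) ⟨i, hi⟩
  rwa [b.toCoweightBasis_apply] at this

lemma weylVector_mem_weylChamber : weylVector b ∈ weylChamber (b.support : Set H.root) := by
  intro i hi
  rw [weylVector_apply_coroot hi]
  simp

lemma root_reflectionPerm_self_apply (i : H.root) :
    (rootSystem H).root ((rootSystem H).reflectionPerm i i) = -(rootSystem H).root i := by
  rw [RootPairing.root_reflectionPerm, RootPairing.reflection_apply_self]

lemma coroot_reflectionPerm_self_apply (i : H.root) :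
    (rootSystem H).coroot ((rootSystem H).reflectionPerm i i) = -(rootSystem H).coroot i := by
  rw [RootPairing.coroot_reflectionPerm, RootPairing.coreflection_apply_self]

lemma isPos_of_reEval_pos (hw : ∀ i ∈ b.support, 0 < reEval ℓ w ((rootSystem H).root i))
    {k : H.root} (hk : 0 < reEval ℓ w ((rootSystem H).root k)) : b.IsPos k := by
  by_contra hneg
  have h1 : b.IsPos ((rootSystem H).reflectionPerm k k) :=
    (RootPairing.Base.IsPos.neg_iff_not b k).mpr hneg
  have h2 := b.root_mem_closure_of_isPos h1
  rw [root_reflectionPerm_self_apply] at h2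
  obtain h3 | h3 := eq_zero_or_pos_of_mem_rootCone (reEval ℓ w) hw h2
  · exact (rootSystem H).ne_zero k (neg_eq_zero.mp h3)
  · rw [map_neg] at h3
    linarith

/-- Positive coroots are non-empty sums of simple coroots. -/
lemma mem_weylChamber_of_isPos {μ : Dual ℂ H} (hμ : μ ∈ weylChamber (b.support : Set H.root))
    {k : H.root} (hk : b.IsPos k) :
    (μ ((rootSystem H).coroot k)).im = 0 ∧ 0 < (μ ((rootSystem H).coroot k)).re := by
  have h0 : (rootSystem H).coroot k ≠ 0 := (rootSystem H).flip.ne_zero k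
  suffices ∀ x ∈ AddSubmonoid.closure ((rootSystem H).coroot '' b.support),
      x = 0 ∨ ((μ x).im = 0 ∧ 0 < (μ x).re) from
    (this _ (b.coroot_mem_closure_of_isPos hk)).resolve_left h0
  intro x hx
  induction hx using AddSubmonoid.closure_induction with
  | mem x hx => obtain ⟨i, hi, rfl⟩ := hx; exact .inr (hμ i hi)
  | zero => exact .inl rfl
  | add x y _ _ hx hy =>
    obtain rfl | hx := hx
    · simpa using hy
    · obtain rfl | hy := hy
      · simpa using Or.inr hx
      · right
        rw [map_add, Complex.add_im, Complex.add_re]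
        exact ⟨by rw [hx.1, hy.1, add_zero], add_pos hx.2 hy.2⟩

/-- `w` is associated with `ℓ` if and only if it maps the simple roots to `ℓ`-positive roots. -/
lemma isAssociated_iff (hℓ : IsGeneric ℓ) :
    IsAssociated b ℓ w ↔ ∀ i ∈ b.support, 0 < reEval ℓ w ((rootSystem H).root i) := by
  refine ⟨fun h i hi ↦ ?_, fun hw ↦ ?_⟩
  · rw [reEval_root]
    by_contra hneg
    have hlt : ((rootSystem H).root (w • i) ℓ).re < 0 := lt_of_le_of_ne (not_lt.mp hneg) (hℓ _)
    -- If -wα_i were ℓ-positive, wρ would pair with its coroot to -1.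
    have hmem : w • weylVector b ∈ weylChamber (positiveRoots ℓ) :=
      h ▸ ⟨_, weylVector_mem_weylChamber, rfl⟩
    have := (hmem ((rootSystem H).reflectionPerm (w • i) (w • i)) (by
      change 0 < ((rootSystem H).root ((rootSystem H).reflectionPerm (w • i) (w • i)) ℓ).re
      rw [root_reflectionPerm_self_apply, LinearMap.neg_apply, Complex.neg_re]
      linarith)).2
    rw [coroot_reflectionPerm_self_apply, map_neg, weylGroup_smul_apply_coroot,
      weylVector_apply_coroot hi] at this
    norm_num at this
  · refine Set.Subset.antisymm ?_ fun ν hν ↦ ?_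
    · rintro _ ⟨μ, hμ, rfl⟩ k hk
      have hpos : b.IsPos (w⁻¹ • k) := isPos_of_reEval_pos hw (by
        rw [reEval_root, smul_inv_smul]; exact hk)
      have := mem_weylChamber_of_isPos hμ hpos
      rwa [← weylGroup_smul_apply_coroot w, smul_inv_smul] at this
    · refine ⟨w⁻¹ • ν, fun i hi ↦ ?_, smul_inv_smul w ν⟩
      rw [← weylGroup_smul_apply_coroot w, smul_inv_smul]
      exact hν _ (by
        have := hw i hi
        rwa [reEval_root] at this)

/-- Let `w` maximize Re (wρ)(ℓ). Comparison with w s_i, where s_i ρ = ρ - α_i, gives Re (wα_i)(ℓ) ≥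
0, and genericity makes it strict. -/
lemma exists_isAssociated (b : (rootSystem H).Base) (hℓ : IsGeneric ℓ) :
    ∃ w, IsAssociated b ℓ w := by
  have := RootPairing.finite_weylGroup (P := rootSystem H)
  obtain ⟨w, hw⟩ := Finite.exists_max fun w : (rootSystem H).weylGroup ↦ reEval ℓ w (weylVector b)
  refine ⟨w, (isAssociated_iff hℓ).mpr fun i hi ↦ ?_⟩
  have h1 := hw (w * RootPairing.weylGroup.ofIdx _ i)
  have h2 : reEval ℓ (w * RootPairing.weylGroup.ofIdx _ i) (weylVector b) =
      reEval ℓ w (weylVector b - (rootSystem H).root i) := by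
    rw [reEval_apply, mul_smul, RootPairing.ofIdx_smul_weight, reEval_apply,
      RootPairing.reflection_apply]
    congr 4
    change weylVector b ((rootSystem H).coroot i) • _ = _
    rw [weylVector_apply_coroot hi, one_smul]
  rw [h2, map_sub, sub_le_self_iff] at h1
  refine lt_of_le_of_ne h1 (Ne.symm ?_)
  rw [reEval_root]
  exact hℓ _

/-- The quotient w'⁻¹w maps simple roots to positive roots, hence is trivial. -/
lemma IsAssociated.unique (hℓ : IsGeneric ℓ) {w' : (rootSystem H).weylGroup}
    (h : IsAssociated b ℓ w) (h' : IsAssociated b ℓ w') : w' = w := by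
  rw [isAssociated_iff hℓ] at h h'
  rw [← inv_mul_eq_one]
  refine b.eq_one_of_forall_isPos_smul _ fun i hi ↦ isPos_of_reEval_pos h' ?_
  rw [reEval_root, mul_smul, smul_inv_smul, ← reEval_root]
  exact h i hi

end Chamber

end ODEIM

theorem proposition5p1
    {g : Type*} [LieRing g] [LieAlgebra ℂ g] [FiniteDimensional ℂ g] [LieAlgebra.IsSimple ℂ g]
    (H : LieSubalgebra ℂ g) [H.IsCartanSubalgebra] (b : (rootSystem H).Base)
    (hADE : b.cartanMatrix.IsSimplyLaced) (ℓ : H) (hℓ : ODEIM.IsGeneric ℓ) :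
    (∃! w : (rootSystem H).weylGroup, ODEIM.IsAssociated b ℓ w) ∧
    ∀ w : (rootSystem H).weylGroup, ODEIM.IsAssociated b ℓ w →
      (∀ ω : Module.Dual ℂ H, ODEIM.IsDominantIntegral b ω →
        ∀ (V : Type*) [AddCommGroup V] [Module ℂ V] [LieRingModule g V] [LieModule ℂ g V],
          ODEIM.IsIrreducibleHighestWeight b ω V →
            w • ω ∈ ODEIM.weights H V ∧
            ODEIM.multiplicity V (w • ω) = 1 ∧
            ∀ μ ∈ ODEIM.weights H V, μ ≠ w • ω → (μ ℓ).re < ((w • ω) ℓ).re) ∧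
      (∀ i : b.support,
        ∀ (V : Type*) [AddCommGroup V] [Module ℂ V] [LieRingModule g V] [LieModule ℂ g V],
          ODEIM.IsIrreducibleHighestWeight b (ODEIM.fundamentalWeight b i) V →
            w • (ODEIM.fundamentalWeight b i - (rootSystem H).root i) ∈ ODEIM.weights H V ∧
            ODEIM.multiplicity V
              (w • (ODEIM.fundamentalWeight b i - (rootSystem H).root i)) = 1 ∧
            ((w • (ODEIM.fundamentalWeight b i - (rootSystem H).root i)) ℓ).re <
              ((w • ODEIM.fundamentalWeight b i) ℓ).re ∧
            ∀ μ ∈ ODEIM.weights H V, μ ≠ w • ODEIM.fundamentalWeight b i →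
              μ ≠ w • (ODEIM.fundamentalWeight b i - (rootSystem H).root i) →
              (μ ℓ).re <
                ((w • (ODEIM.fundamentalWeight b i - (rootSystem H).root i)) ℓ).re) := by
  refine ⟨?_, fun w hw ↦ ⟨fun ω hω V _ _ _ _ hV ↦ ?_, fun i V _ _ _ _ hV ↦ ?_⟩⟩
  · obtain ⟨w, hw⟩ := ODEIM.exists_isAssociated b hℓ
    exact ⟨w, hw, fun w' hw' ↦ hw.unique hℓ hw'⟩
  · obtain ⟨hirr, v, hv⟩ := hV
    rw [ODEIM.isAssociated_iff hℓ] at hw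
    have hmult : ODEIM.multiplicity V (w • ω) = 1 :=
      (hv.multiplicity_weylGroup_smul hω w ω).trans hv.multiplicity_eq_one
    refine ⟨ODEIM.mem_weights_iff_multiplicity_ne_zero.mpr (by rw [hmult]; exact one_ne_zero),
      hmult, fun μ hμ hne ↦ ?_⟩
    -- By Weyl invariance w⁻¹μ is again a weight, hence of the form ω - δ.
    obtain ⟨μ, rfl⟩ : ∃ ν, μ = w • ν := ⟨w⁻¹ • μ, (smul_inv_smul w μ).symm⟩
    rw [hv.weylGroup_smul_mem_weights_iff hω] at hμ
    obtain ⟨δ, hδ, rfl⟩ := hv.exists_rootCone_of_mem_weights hμ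
    rw [← ODEIM.reEval_apply, ← ODEIM.reEval_apply, map_sub, sub_lt_self_iff]
    refine (ODEIM.eq_zero_or_pos_of_mem_rootCone _ hw hδ).resolve_left ?_
    rintro rfl
    exact hne (by rw [sub_zero])
  · obtain ⟨hirr, v, hv⟩ := hV
    have hω := ODEIM.isDominantIntegral_fundamentalWeight i
    rw [ODEIM.isAssociated_iff hℓ] at hw
    have hmult : ODEIM.multiplicity V
        (w • (ODEIM.fundamentalWeight b i - (rootSystem H).root i)) = 1 :=
      (hv.multiplicity_weylGroup_smul hω w _).trans hv.multiplicity_fundamentalWeight_sub_root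
    refine ⟨ODEIM.mem_weights_iff_multiplicity_ne_zero.mpr (by rw [hmult]; exact one_ne_zero),
      hmult, ?_, fun μ hμ hne hne' ↦ ?_⟩
    · rw [← ODEIM.reEval_apply, ← ODEIM.reEval_apply, map_sub, sub_lt_self_iff]
      exact hw i i.2
    · obtain ⟨μ, rfl⟩ : ∃ ν, μ = w • ν := ⟨w⁻¹ • μ, (smul_inv_smul w μ).symm⟩
      rw [hv.weylGroup_smul_mem_weights_iff hω] at hμ
      obtain rfl | ⟨ε, hε, rfl⟩ := hv.eq_or_of_mem_weights_fundamentalWeight hμ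
      · exact absurd rfl hne
      rw [← ODEIM.reEval_apply, ← ODEIM.reEval_apply, map_sub _ _ ε, sub_lt_self_iff]
      refine (ODEIM.eq_zero_or_pos_of_mem_rootCone _ hw hε).resolve_left ?_
      rintro rfl
      exact hne' (by rw [sub_zero])
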